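/- For an integer $v\ge 3$ let $X_v$ be a random variable having Student's $t$-distribution with $v$ degrees of freedom, i.e. with density $$f_v(x)=\frac{\Gamma(\frac{v+1}{2})}{\sqrt{v\pi}\,\Gamma(\frac v2)}\Bigl(1+\frac{x^2}{v}\Bigr)^{-\frac{v+1}{2}},\qquad x\in\mathbb R,$$ and let $F_v$ be its distribution function. Let $\Phi$ be the distribution function of the standard normal distribution. For $y>0$ define $$C(y)=\inf_{v\ge 3}P\bigl(X_v\le y\,E(X_v)\bigr),$$ $$T(y)=\inf_{v\ge 3}P\bigl(|X_v-E(X_v)|\le y\sqrt{\mathrm{Var}(X_v)}\bigr),\qquad H(y)=\inf_{v\ge 3}P\bigl(|X_v-E(X_v)|\ge y\sqrt{\mathrm{Var}(X_v)}\bigr),$$ where the infima are over integers $v\ge 3$ (here $E(X_v)=0$ and $\mathrm{Var}(X_v)=\frac{v}{v-2}$). For $y>1$, $y\ne\sqrt3$, put $$C_1=2y^6+\tfrac34y^4,\qquad C_2=\tfrac94C_1+\tfrac{25}{32}y^8+\tfrac32\bigl(C_1^{2/3}y^{8/3}+C_1^{1/3}y^{16/3}\bigr),\qquad C_3=\tfrac{13}{3}y^4+18y^2+2C_2+11,$$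 $$V_1=\max\{100,\,8y^2\},\qquad V_2=\max\Bigl\{V_1,\tfrac{3y^4}{2},\sqrt{2C_1}\Bigr\},\qquad V_3=\max\Bigl\{V_2,\,2+\tfrac{2y^2}{1+2y},\,2+\tfrac{2y^4}{1+2y^2}\Bigr\},$$ $$v_0(y)=\max\Bigl\{V_3,\ \frac{2C_3}{|y^2-3|}+1\Bigr\},$$ and put $\bar v_0(\sqrt3)=1318.4$. Write $[r]$ for the integer part of $r$; all minima are over integers $v$. Then for every $y>0$: (i) $C(y)=\frac12$. (ii) $$T(y)=\begin{cases} 2\Phi(y)-1, & 0<y\le 1,\\[2pt] \min\Bigl\{\min\limits_{3\le v\le [v_0(y)]+3}\bigl\{2F_v\bigl(y\sqrt{\tfrac{v}{v-2}}\bigr)-1\bigr\},\ 2\Phi(y)-1\Bigr\}, & 1<y<\sqrt3,\\[2pt] \min\Bigl\{\min\limits_{3\le v\le [\bar v_0(\sqrt3)]+3}\bigl\{2F_v\bigl(\sqrt{\tfrac{3v}{v-2}}\bigr)-1\bigr\},\ 2\Phi(\sqrt3)-1\Bigr\}, & y=\sqrt3,\\[2pt] \min\limits_{3\le v\le [v_0(y)]+3}\bigl\{2F_v\bigl(y\sqrt{\tfrac{v}{v-2}}\bigr)-1\bigr\},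 & y>\sqrt3. \end{cases}$$ (iii) $$H(y)=\begin{cases} \min\limits_{v=3,4}\bigl\{2-2F_v\bigl(y\sqrt{\tfrac{v}{v-2}}\bigr)\bigr\}, & 0<y\le 1,\\[2pt] \min\limits_{3\le v\le [v_0(y)]+3}\bigl\{2-2F_v\bigl(y\sqrt{\tfrac{v}{v-2}}\bigr)\bigr\}, & 1<y<\sqrt3,\\[2pt] \min\limits_{3\le v\le [\bar v_0(\sqrt3)]+3}\bigl\{2-2F_v\bigl(\sqrt{\tfrac{3v}{v-2}}\bigr)\bigr\}, & y=\sqrt3,\\[2pt] \min\Bigl\{\min\limits_{3\le v\le [v_0(y)]+3}\bigl\{2-2F_v\bigl(y\sqrt{\tfrac{v}{v-2}}\bigr)\bigr\},\ 2-2\Phi(y)\Bigr\}, & y>\sqrt3. \end{cases}$$ -/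

import Mathlib

open MeasureTheory ProbabilityTheory

noncomputable section

namespace StudentT

/-- Density of Student's `t`-distribution with `v` degrees of freedom. -/
def pdfReal (v : ℕ) (x : ℝ) : ℝ :=
  Real.Gamma (((v : ℝ) + 1) / 2) / (√((v : ℝ) * Real.pi) * Real.Gamma ((v : ℝ) / 2)) *
    (1 + x ^ 2 / (v : ℝ)) ^ (-(((v : ℝ) + 1) / 2))

/-- Student's `t`-distribution with `v` degrees of freedom, i.e. the law of `X_v`. -/
def law (v : ℕ) : Measure ℝ :=
  volume.withDensity fun x => ENNReal.ofReal (pdfReal v x)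

/-- The distribution function `F_v` of `X_v`. -/
def F (v : ℕ) (x : ℝ) : ℝ := cdf (law v) x

/-- The standard normal distribution function. -/
def Phi (x : ℝ) : ℝ := cdf (gaussianReal 0 1) x

/-- `inf_α P(X_α ≤ y E(X_α))` for a family of real random variables `X_α` with laws `μ α`. -/
def infLeMean {ι : Type*} (μ : ι → Measure ℝ) (y : ℝ) : ℝ :=
  ⨅ α, (μ α).real {x | x ≤ y * ∫ t, t ∂(μ α)}

/-- `inf_α P(|X_α - E(X_α)| ≤ y √Var(X_α))` for a family of real random variables `X_α` with
laws `μ α`. -/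
def infConc {ι : Type*} (μ : ι → Measure ℝ) (y : ℝ) : ℝ :=
  ⨅ α, (μ α).real {x | |x - ∫ t, t ∂(μ α)| ≤ y * √(variance id (μ α))}

/-- `inf_α P(|X_α - E(X_α)| ≥ y √Var(X_α))` for a family of real random variables `X_α` with
laws `μ α`. -/
def infAntiConc {ι : Type*} (μ : ι → Measure ℝ) (y : ℝ) : ℝ :=
  ⨅ α, (μ α).real {x | |x - ∫ t, t ∂(μ α)| ≥ y * √(variance id (μ α))}

/-- The family of `t`-distributions with an integer number `v ≥ 3` of degrees of freedom. -/
def family (v : {v : ℕ // 3 ≤ v}) : Measure ℝ := law v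

/-- The function `C` for the family of `t`-distributions. -/
def C (y : ℝ) : ℝ := infLeMean family y

/-- The function `T` for the family of `t`-distributions. -/
def T (y : ℝ) : ℝ := infConc family y

/-- The function `H` for the family of `t`-distributions. -/
def H (y : ℝ) : ℝ := infAntiConc family y

def C₁ (y : ℝ) : ℝ := 2 * y ^ 6 + 3 / 4 * y ^ 4

def C₂ (y : ℝ) : ℝ :=
  9 / 4 * C₁ y + 25 / 32 * y ^ 8 +
    3 / 2 * (C₁ y ^ (2 / 3 : ℝ) * y ^ (8 / 3 : ℝ) + C₁ y ^ (1 / 3 : ℝ) * y ^ (16 / 3 : ℝ))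

def C₃ (y : ℝ) : ℝ := 13 / 3 * y ^ 4 + 18 * y ^ 2 + 2 * C₂ y + 11

def V₁ (y : ℝ) : ℝ := max 100 (8 * y ^ 2)

def V₂ (y : ℝ) : ℝ := max (V₁ y) (max (3 * y ^ 4 / 2) (√(2 * C₁ y)))

def V₃ (y : ℝ) : ℝ :=
  max (V₂ y) (max (2 + 2 * y ^ 2 / (1 + 2 * y)) (2 + 2 * y ^ 4 / (1 + 2 * y ^ 2)))

/-- The explicit bound `v₀(y)`, used for `1 < y`, `y ≠ √3`. -/
def v₀ (y : ℝ) : ℝ := max (V₃ y) (2 * C₃ y / |y ^ 2 - 3| + 1)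

/-- The bound used for `y = √3`. -/
def vbar₀ : ℝ := 1318.4

/-- The minimum of `f v` over the integers `3 ≤ v ≤ ⌊r⌋ + 3` (for `r ≥ 0`). -/
def minUpTo (r : ℝ) (f : ℕ → ℝ) : ℝ :=
  (Finset.Icc 3 (⌊r⌋₊ + 3)).inf' (Finset.nonempty_Icc.2 (Nat.le_add_left 3 ⌊r⌋₊)) f

end StudentT

end

namespace StudentT

open Filter Topology

/-! By symmetry everything reduces to p(v) = P(|X_v| ≤ yσ_v), which is `concProb y v`: T is the
infimum of p and H that of 1 - p. In the variable t = x/√v the density is proportional to `kernel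
v`, and p(v) is an integral up to y/√(v-2). Integrating the derivative of t * `kernel v t` links v
to v + 2, and the endpoint for v + 2 is a = y/√v. Hence p(v+2) - p(v) has the sign of a k(a)/v - ∫ k
over [a, Wa], where k = `kernel v` and W = √(v/(v-2)) (`concProb_add_two_sub`).

Taylor bounds for k on this short interval make the first-order terms in W - 1 cancel. What remains
compares a quantity tending to y²/2 with one tending to 3/2, whence the threshold √3. For y ≤ √3, p
decreases along steps of two once v ≥ 100 (once v ≥ 3 if y ≤ 1); for y > √3 it increases once 2y⁴ ≤
(y²-3)v and v ≥ 100.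

Dominated convergence gives p(v) → 2Φ(y) - 1. An eventually decreasing sequence has as infimum the
smaller of an initial minimum and its limit; an eventually increasing one needs only the initial
minimum. Passing to 1 - p exchanges the two cases. -/

/-! ### The kernel: two-step recursion and total mass -/

/-- The unnormalised density of `X_v / √v`. -/
noncomputable def kernel (v : ℕ) (t : ℝ) : ℝ := (1 + t ^ 2) ^ (-(((v : ℝ) + 1) / 2))

/-- The total mass of `kernel v`. -/
noncomputable def mass (v : ℕ) : ℝ := ∫ t, kernel v t

lemma kernel_pos (v : ℕ) (t : ℝ) : 0 < kernel v t := by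
  unfold kernel; positivity

lemma kernel_neg (v : ℕ) (t : ℝ) : kernel v (-t) = kernel v t := by
  simp [kernel]

lemma continuous_kernel (v : ℕ) : Continuous (kernel v) := by
  unfold kernel
  refine Continuous.rpow_const (by fun_prop) fun x => Or.inl (by positivity)

lemma kernel_eq_mul_kernel_add_two (v : ℕ) (t : ℝ) :
    kernel v t = (1 + t ^ 2) * kernel (v + 2) t := by
  have h : (0 : ℝ) < 1 + t ^ 2 := by positivity
  unfold kernel
  nth_rewrite 2 [← Real.rpow_one (1 + t ^ 2)]
  rw [← Real.rpow_add h]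
  congr 1
  push_cast
  ring

/-- Source of every recursion below, over finite intervals and over the line. The case v = 0 is kept
because it exhibits `kernel 2` as a derivative. -/
lemma hasDerivAt_mul_kernel (v : ℕ) (t : ℝ) :
    HasDerivAt (fun t => t * kernel v t) ((v + 1) * kernel (v + 2) t - v * kernel v t) t := by
  have h : (0 : ℝ) < 1 + t ^ 2 := by positivity
  have h1 : HasDerivAt (fun t : ℝ => 1 + t ^ 2) (2 * t) t := by
    simpa using (hasDerivAt_pow 2 t).const_add 1
  have h2 := (hasDerivAt_id' t).mul
    (h1.rpow_const (p := -(((v : ℝ) + 1) / 2)) (Or.inl h.ne'))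
  refine h2.congr_deriv ?_
  have h3 : (1 + t ^ 2) ^ (-(((v : ℝ) + 1) / 2) - 1) = kernel (v + 2) t := by
    unfold kernel; congr 1; push_cast; ring
  have h4 : (1 + t ^ 2) ^ (-(((v : ℝ) + 1) / 2)) = (1 + t ^ 2) * kernel (v + 2) t :=
    kernel_eq_mul_kernel_add_two v t
  rw [h3, h4, kernel_eq_mul_kernel_add_two v t]
  ring

lemma integral_kernel_add_two (v : ℕ) (T : ℝ) :
    (v + 1) * ∫ t in (0 : ℝ)..T, kernel (v + 2) t =
      v * (∫ t in (0 : ℝ)..T, kernel v t) + T * kernel v T := by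
  have hi := fun v : ℕ => (continuous_kernel v).intervalIntegrable (μ := volume) 0 T
  have h := intervalIntegral.integral_eq_sub_of_hasDerivAt
    (fun t _ => hasDerivAt_mul_kernel v t) (((hi (v + 2)).const_mul _).sub ((hi v).const_mul _))
  rw [intervalIntegral.integral_sub ((hi (v + 2)).const_mul _) ((hi v).const_mul _),
    intervalIntegral.integral_const_mul, intervalIntegral.integral_const_mul] at h
  simp only [zero_mul, sub_zero] at h
  linarith

lemma integrable_kernel {v : ℕ} (hv : 1 ≤ v) : Integrable (kernel v) := by
  have hv' : (1 : ℝ) ≤ v := by exact_mod_cast hv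
  have := integrable_rpow_neg_one_add_norm_sq (E := ℝ) (μ := volume) (r := (v : ℝ) + 1)
    (by simp; linarith)
  refine this.congr (Eventually.of_forall fun t => ?_)
  simp only [kernel, Real.norm_eq_abs, sq_abs]
  congr 1
  ring

lemma tendsto_mul_kernel_atTop {v : ℕ} (hv : 1 ≤ v) :
    Tendsto (fun t => t * kernel v t) atTop (𝓝 0) := by
  have hv' : (1 : ℝ) ≤ v := by exact_mod_cast hv
  have h1 : Tendsto (fun t : ℝ => (1 + t ^ 2) ^ (-((v : ℝ) / 2))) atTop (𝓝 0) := by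
    refine (tendsto_rpow_neg_atTop (by positivity)).comp ?_
    exact tendsto_atTop_add_const_left _ _ (tendsto_pow_atTop two_ne_zero)
  refine tendsto_of_tendsto_of_tendsto_of_le_of_le' tendsto_const_nhds h1 ?_ ?_
  · filter_upwards [eventually_ge_atTop 0] with t ht
    exact mul_nonneg ht (kernel_pos v t).le
  · refine Eventually.of_forall fun t => ?_
    have h : (0 : ℝ) < 1 + t ^ 2 := by positivity
    have h2 : t ≤ (1 + t ^ 2) ^ (1 / 2 : ℝ) := by
      rw [← Real.sqrt_eq_rpow]
      exact Real.le_sqrt_of_sq_le (by linarith)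
    calc t * kernel v t ≤ (1 + t ^ 2) ^ (1 / 2 : ℝ) * kernel v t :=
          mul_le_mul_of_nonneg_right h2 (kernel_pos v t).le
      _ = (1 + t ^ 2) ^ (-((v : ℝ) / 2)) := by
          unfold kernel; rw [← Real.rpow_add h]; congr 1; ring

lemma tendsto_mul_kernel_atBot {v : ℕ} {a : ℝ}
    (h : Tendsto (fun t => t * kernel v t) atTop (𝓝 a)) :
    Tendsto (fun t => t * kernel v t) atBot (𝓝 (-a)) := by
  refine (h.comp tendsto_neg_atBot_atTop).neg.congr fun t => ?_
  simp [kernel_neg]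

lemma mass_add_two {v : ℕ} (hv : 1 ≤ v) : (v + 1) * mass (v + 2) = v * mass v := by
  have i1 := integrable_kernel hv
  have i2 := integrable_kernel (v := v + 2) (by omega)
  have h := integral_of_hasDerivAt_of_tendsto (hasDerivAt_mul_kernel v)
    ((i2.const_mul _).sub (i1.const_mul _))
    (tendsto_mul_kernel_atBot (tendsto_mul_kernel_atTop hv)) (tendsto_mul_kernel_atTop hv)
  rw [integral_sub (i2.const_mul _) (i1.const_mul _), integral_const_mul, integral_const_mul] at h
  simp only [neg_zero, sub_zero] at h
  unfold mass
  linarith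

lemma mass_one : mass 1 = Real.pi := by
  rw [← integral_univ_inv_one_add_sq]
  refine integral_congr_ae (Eventually.of_forall fun t => ?_)
  norm_num [kernel, Real.rpow_neg_one]

/-- Boundary values for the base case `mass_two`; `kernel 0` itself is not integrable. -/
lemma tendsto_mul_kernel_zero_atTop : Tendsto (fun t => t * kernel 0 t) atTop (𝓝 1) := by
  have h1 : Tendsto (fun t : ℝ => ((t ^ 2)⁻¹ + 1) ^ (-(1 / 2) : ℝ)) atTop (𝓝 1) := by
    have h : Tendsto (fun t : ℝ => (t ^ 2)⁻¹ + 1) atTop (𝓝 (0 + 1)) :=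
      (tendsto_inv_atTop_zero.comp (tendsto_pow_atTop two_ne_zero)).add_const 1
    simpa using h.rpow_const (p := -(1 / 2)) (Or.inl (by norm_num))
  refine h1.congr' ?_
  filter_upwards [eventually_gt_atTop 0] with t ht
  have e : (t ^ 2)⁻¹ + 1 = (1 + t ^ 2) * t ^ (-2 : ℝ) := by
    rw [Real.rpow_neg ht.le, Real.rpow_two]; field_simp
  rw [e, Real.mul_rpow (by positivity) (by positivity), ← Real.rpow_mul ht.le]
  norm_num [kernel, mul_comm]

lemma mass_two : mass 2 = 2 := by
  have h := integral_of_hasDerivAt_of_tendsto (f' := kernel 2)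
    (fun t => by simpa using hasDerivAt_mul_kernel 0 t) (integrable_kernel (by norm_num))
    (tendsto_mul_kernel_atBot tendsto_mul_kernel_zero_atTop) tendsto_mul_kernel_zero_atTop
  unfold mass
  rw [h]; norm_num

/-- Both sides satisfy the recursion of `mass_add_two`, by Γ(s+1) = sΓ(s), and agree at 1 and 2. -/
lemma mass_eq (v : ℕ) : mass (v + 1) =
    √Real.pi * Real.Gamma (((v + 1 : ℕ) : ℝ) / 2) / Real.Gamma ((((v + 1 : ℕ) : ℝ) + 1) / 2) := by
  induction v using Nat.twoStepInduction with
  | zero =>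
    norm_num [mass_one, Real.Gamma_one_half_eq, -one_div, Real.mul_self_sqrt Real.pi_pos.le]
  | one =>
    have h : Real.Gamma (3 / 2) = 1 / 2 * √Real.pi := by
      rw [← Real.Gamma_one_half_eq, ← Real.Gamma_add_one (by norm_num)]; norm_num
    have : √Real.pi ≠ 0 := by positivity
    norm_num [mass_two, h]
    field_simp
  | more n ih _ =>
    have h := mass_add_two (v := n + 1) (by omega)
    have e1 : (((n + 2 + 1 : ℕ) : ℝ)) / 2 = ((n + 1 : ℕ) : ℝ) / 2 + 1 := by push_cast; ring
    have e2 : (((n + 2 + 1 : ℕ) : ℝ) + 1) / 2 = (((n + 1 : ℕ) : ℝ) + 1) / 2 + 1 := by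
      push_cast; ring
    rw [e1, e2, Real.Gamma_add_one (by positivity), Real.Gamma_add_one (by positivity)]
    have g2 : 0 < Real.Gamma ((((n + 1 : ℕ) : ℝ) + 1) / 2) := Real.Gamma_pos_of_pos (by positivity)
    have h0 : (0 : ℝ) < ((n + 1 : ℕ) : ℝ) + 1 := by positivity
    rw [ih] at h
    rw [show n + 2 + 1 = n + 1 + 2 by ring, eq_div_iff (by positivity)]
    field_simp at h ⊢
    linarith

lemma mass_pos {v : ℕ} (hv : 1 ≤ v) : 0 < mass v := by
  obtain ⟨n, rfl⟩ : ∃ n, v = n + 1 := ⟨v - 1, by omega⟩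
  rw [mass_eq]
  have h1 : 0 < Real.Gamma (((n + 1 : ℕ) : ℝ) / 2) := Real.Gamma_pos_of_pos (by positivity)
  have h2 : 0 < Real.Gamma ((((n + 1 : ℕ) : ℝ) + 1) / 2) := Real.Gamma_pos_of_pos (by positivity)
  positivity

/-! ### The law: normalisation, symmetry, absence of atoms -/

lemma pdfReal_eq {v : ℕ} (hv : 1 ≤ v) (x : ℝ) :
    pdfReal v x = (√v * mass v)⁻¹ * kernel v (x / √v) := by
  obtain ⟨n, rfl⟩ : ∃ n, v = n + 1 := ⟨v - 1, by omega⟩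
  have hs : √((n + 1 : ℕ) : ℝ) ^ 2 = ((n + 1 : ℕ) : ℝ) := Real.sq_sqrt (by positivity)
  rw [pdfReal, mass_eq, kernel, div_pow, hs, Real.sqrt_mul (by positivity)]
  congr 1
  have h1 : 0 < Real.Gamma (((n + 1 : ℕ) : ℝ) / 2) := Real.Gamma_pos_of_pos (by positivity)
  have h2 : 0 < Real.Gamma ((((n + 1 : ℕ) : ℝ) + 1) / 2) := Real.Gamma_pos_of_pos (by positivity)
  have h3 : (0 : ℝ) < √Real.pi := by positivity
  have h4 : (0 : ℝ) < √((n + 1 : ℕ) : ℝ) := by positivity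
  field_simp

lemma pdfReal_nonneg {v : ℕ} (hv : 1 ≤ v) (x : ℝ) : 0 ≤ pdfReal v x := by
  rw [pdfReal_eq hv]
  have := mass_pos hv
  have := kernel_pos v (x / √v)
  positivity

lemma pdfReal_neg (v : ℕ) (x : ℝ) : pdfReal v (-x) = pdfReal v x := by
  simp [pdfReal]

lemma integrable_pdfReal {v : ℕ} (hv : 1 ≤ v) : Integrable (pdfReal v) := by
  have h0 : √(v : ℝ) ≠ 0 := by positivity
  exact (((integrable_kernel hv).comp_div h0).const_mul _).congr
    (Eventually.of_forall fun x => (pdfReal_eq hv x).symm)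

lemma measurable_pdfReal (v : ℕ) : Measurable (pdfReal v) := by
  unfold pdfReal; fun_prop

lemma integral_pdfReal {v : ℕ} (hv : 1 ≤ v) : ∫ x, pdfReal v x = 1 := by
  have h0 : 0 < √(v : ℝ) := by positivity
  have := mass_pos hv
  simp_rw [pdfReal_eq hv]
  rw [integral_const_mul, Measure.integral_comp_div (kernel v), ← mass, abs_of_pos h0, smul_eq_mul]
  field_simp

lemma isProbabilityMeasure_law {v : ℕ} (hv : 1 ≤ v) : IsProbabilityMeasure (law v) := by
  refine ⟨?_⟩
  rw [law, withDensity_apply _ .univ, Measure.restrict_univ,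
    ← ofReal_integral_eq_lintegral_ofReal (integrable_pdfReal hv)
      (Eventually.of_forall (pdfReal_nonneg hv)), integral_pdfReal hv, ENNReal.ofReal_one]

lemma integral_law {v : ℕ} (hv : 1 ≤ v) (g : ℝ → ℝ) :
    ∫ x, g x ∂(law v) = ∫ x, pdfReal v x * g x := by
  rw [law, integral_withDensity_eq_integral_toReal_smul (measurable_pdfReal v).ennreal_ofReal
    (by simp)]
  simp [ENNReal.toReal_ofReal (pdfReal_nonneg hv _)]

lemma law_real_apply {v : ℕ} (hv : 1 ≤ v) {s : Set ℝ} (hs : MeasurableSet s) :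
    (law v).real s = ∫ x in s, pdfReal v x := by
  rw [measureReal_def, law, withDensity_apply _ hs,
    ← ofReal_integral_eq_lintegral_ofReal (integrable_pdfReal hv).integrableOn
      (Eventually.of_forall (pdfReal_nonneg hv)), ENNReal.toReal_ofReal]
  exact setIntegral_nonneg hs fun x _ => pdfReal_nonneg hv x

lemma law_real_singleton (v : ℕ) (x : ℝ) : (law v).real {x} = 0 := by
  rw [measureReal_def, law, withDensity_absolutelyContinuous _ _ (measure_singleton x)]
  rfl

lemma law_map_neg (v : ℕ) : (law v).map (fun x => -x) = law v := by
  ext s hs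
  rw [Measure.map_apply measurable_neg hs, law, withDensity_apply _ (measurable_neg hs),
    withDensity_apply _ hs, ← lintegral_indicator hs, ← lintegral_indicator (measurable_neg hs),
    ← lintegral_neg_eq_self]
  congr 1
  ext x
  by_cases h : x ∈ s <;> simp [Set.indicator, h, pdfReal_neg]

lemma measureReal_Iio_neg {μ : Measure ℝ} (hμ : μ.map (fun x => -x) = μ) (x : ℝ) :
    μ.real (Set.Iio (-x)) = μ.real (Set.Ioi x) := by
  conv_lhs => rw [← hμ, map_measureReal_apply measurable_neg measurableSet_Iio]
  congr 1; ext; simp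

section Symmetric

variable {μ : Measure ℝ} [IsProbabilityMeasure μ]

/-- Central intervals of a symmetric probability measure in terms of its distribution function. -/
lemma measureReal_abs_le (hμ : μ.map (fun x => -x) = μ) {x : ℝ} (hx : 0 ≤ x) :
    μ.real {t | |t| ≤ x} = 2 * cdf μ x - 1 := by
  have e : {t : ℝ | |t| ≤ x} = Set.Iic x \ Set.Iio (-x) := by
    ext t; simp [abs_le, and_comm]
  have e2 : μ.real (Set.Ioi x) = 1 - μ.real (Set.Iic x) := by
    rw [← Set.compl_Iic, probReal_compl_eq_one_sub measurableSet_Iic]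
  rw [e, measureReal_sdiff (fun t ht => by simp at ht ⊢; linarith) measurableSet_Iio,
    measureReal_Iio_neg hμ, e2, cdf_eq_real]
  ring

lemma measureReal_Iic_zero (hμ : μ.map (fun x => -x) = μ) (h0 : μ.real {0} = 0) :
    μ.real (Set.Iic 0) = 1 / 2 := by
  have h := measureReal_abs_le hμ le_rfl
  have e : {t : ℝ | |t| ≤ 0} = {0} := by ext; simp
  rw [e, h0, cdf_eq_real] at h
  linarith

lemma measureReal_le_abs (h0 : ∀ x, μ.real {x} = 0) (x : ℝ) :
    μ.real {t | x ≤ |t|} = 1 - μ.real {t | |t| ≤ x} := by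
  have hm : MeasurableSet {t : ℝ | |t| ≤ x} := measurableSet_le (by fun_prop) (by fun_prop)
  rw [← probReal_compl_eq_one_sub hm]
  refine le_antisymm ?_ (measureReal_mono fun t ht => ?_)
  · have : {t : ℝ | x ≤ |t|} ⊆ {t | |t| ≤ x}ᶜ ∪ ({x} ∪ {-x}) := by
      intro t ht
      rcases (show x ≤ |t| from ht).lt_or_eq with h | h
      · left; simpa using h
      · right
        rcases abs_cases t with ⟨h', _⟩ | ⟨h', _⟩
        · left; simp [h, h']
        · right; simp [h, h']
    refine (measureReal_mono this).trans ((measureReal_union_le _ _).trans ?_)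
    have := measureReal_union_le (μ := μ) {x} {-x}
    rw [h0, h0] at this
    linarith
  · simp only [Set.mem_compl_iff, Set.mem_ofPred_eq, not_le] at ht ⊢
    exact ht.le

end Symmetric

/-! ### Mean, variance, and reduction to central probabilities -/

lemma integral_id_law {v : ℕ} (hv : 1 ≤ v) : ∫ x, x ∂(law v) = 0 := by
  rw [integral_law hv]
  have h := integral_neg_eq_self (fun x => pdfReal v x * x) volume
  simp only [pdfReal_neg, mul_neg, integral_neg] at h
  linarith

/-- Since t² k_v = k_{v-2} - k_v, the second moment comes from the mass recursion. -/
lemma integral_sq_mul_kernel {v : ℕ} (hv : 3 ≤ v) :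
    (v - 2) * ∫ t, t ^ 2 * kernel v t = mass v := by
  obtain ⟨n, rfl⟩ : ∃ n, v = n + 1 + 2 := ⟨v - 3, by omega⟩
  have e : ∀ t, t ^ 2 * kernel (n + 1 + 2) t = kernel (n + 1) t - kernel (n + 1 + 2) t := by
    intro t; rw [kernel_eq_mul_kernel_add_two (n + 1)]; ring
  simp_rw [e]
  rw [integral_sub (integrable_kernel (by omega)) (integrable_kernel (by omega)), ← mass, ← mass]
  have := mass_add_two (v := n + 1) (by omega)
  push_cast at *
  linarith

lemma variance_law {v : ℕ} (hv : 3 ≤ v) : variance id (law v) = v / (v - 2) := by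
  have hv1 : 1 ≤ v := by omega
  have hv' : (3 : ℝ) ≤ v := by exact_mod_cast hv
  have h0 : 0 < √(v : ℝ) := by positivity
  have hs : √(v : ℝ) ^ 2 = v := Real.sq_sqrt (by positivity)
  have hm := mass_pos hv1
  have := isProbabilityMeasure_law hv1
  rw [variance_eq_integral measurable_id.aemeasurable]
  simp only [id, integral_id_law hv1, sub_zero]
  rw [integral_law hv1]
  have e : ∀ x, pdfReal v x * x ^ 2 =
      (√v * mass v)⁻¹ * v * ((x / √v) ^ 2 * kernel v (x / √v)) := by
    intro x
    rw [pdfReal_eq hv1, div_pow, hs]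
    field_simp
  simp_rw [e]
  rw [integral_const_mul, Measure.integral_comp_div (fun t => t ^ 2 * kernel v t), abs_of_pos h0,
    smul_eq_mul]
  have h := integral_sq_mul_kernel hv
  have h2 : (v : ℝ) - 2 ≠ 0 := by linarith
  rw [mul_comm, ← eq_div_iff h2] at h
  rw [h]
  field_simp

/-- The probability that `X_v` lies within `y` standard deviations of its mean. -/
noncomputable def concProb (y : ℝ) (v : ℕ) : ℝ := 2 * F v (y * √((v : ℝ) / ((v : ℝ) - 2))) - 1

lemma measureReal_conc {v : ℕ} (hv : 3 ≤ v) {y : ℝ} (hy : 0 < y) :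
    (law v).real {x | |x| ≤ y * √((v : ℝ) / ((v : ℝ) - 2))} = concProb y v := by
  have := isProbabilityMeasure_law (v := v) (by omega)
  rw [measureReal_abs_le (law_map_neg v) (by positivity)]
  rfl

lemma C_eq_half (y : ℝ) : C y = 1 / 2 := by
  have : Nonempty {v : ℕ // 3 ≤ v} := ⟨⟨3, le_rfl⟩⟩
  unfold C infLeMean
  have h : ∀ v : {v : ℕ // 3 ≤ v}, (family v).real {x | x ≤ y * ∫ t, t ∂(family v)} = 1 / 2 := by
    rintro ⟨v, hv⟩
    have := isProbabilityMeasure_law (v := v) (by omega)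
    simp only [family]
    rw [integral_id_law (by omega), mul_zero]
    exact measureReal_Iic_zero (law_map_neg v) (law_real_singleton v 0)
  simp_rw [h]
  exact ciInf_const

lemma T_eq_iInf {y : ℝ} (hy : 0 < y) : T y = ⨅ v : {v : ℕ // 3 ≤ v}, concProb y v := by
  unfold T infConc
  refine iInf_congr ?_
  rintro ⟨v, hv⟩
  simp only [family]
  rw [integral_id_law (by omega), variance_law hv, ← measureReal_conc hv hy]
  simp

lemma H_eq_iInf {y : ℝ} (hy : 0 < y) : H y = ⨅ v : {v : ℕ // 3 ≤ v}, (1 - concProb y v) := by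
  unfold H infAntiConc
  refine iInf_congr ?_
  rintro ⟨v, hv⟩
  have := isProbabilityMeasure_law (v := v) (by omega)
  simp only [family]
  rw [integral_id_law (by omega), variance_law hv, ← measureReal_conc hv hy,
    ← measureReal_le_abs (law_real_singleton v)]
  simp

/-! ### The difference between v and v + 2 degrees of freedom -/

lemma integral_neg_self_kernel (v : ℕ) (T : ℝ) :
    ∫ t in (-T)..T, kernel v t = 2 * ∫ t in (0 : ℝ)..T, kernel v t := by
  have hi := fun a b => (continuous_kernel v).intervalIntegrable (μ := volume) a b
  have h := intervalIntegral.integral_comp_neg (a := 0) (b := T) (kernel v)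
  simp only [kernel_neg, neg_zero] at h
  rw [← intervalIntegral.integral_add_adjacent_intervals (hi (-T) 0) (hi 0 T), ← h]
  ring

lemma concProb_eq_integral {v : ℕ} (hv : 3 ≤ v) {y : ℝ} (hy : 0 < y) :
    concProb y v = 2 / mass v * ∫ t in (0 : ℝ)..(y / √((v : ℝ) - 2)), kernel v t := by
  have hv' : (3 : ℝ) ≤ v := by exact_mod_cast hv
  have h0 : 0 < √(v : ℝ) := by positivity
  have hm := mass_pos (v := v) (by omega)
  rw [← measureReal_conc hv hy,
    law_real_apply (by omega) (measurableSet_le (by fun_prop) (by fun_prop))]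
  set c := y * √((v : ℝ) / ((v : ℝ) - 2)) with hc
  have e : {x : ℝ | |x| ≤ c} = Set.Icc (-c) c := by ext; simp [abs_le]
  have hc0 : 0 ≤ c := by positivity
  have hcv : c / √v = y / √((v : ℝ) - 2) := by
    rw [hc, Real.sqrt_div (by positivity)]; field_simp
  rw [e, integral_Icc_eq_integral_Ioc, ← intervalIntegral.integral_of_le (by linarith)]
  simp_rw [pdfReal_eq (v := v) (by omega)]
  rw [intervalIntegral.integral_const_mul, intervalIntegral.integral_comp_div _ h0.ne', neg_div,
    integral_neg_self_kernel, hcv, smul_eq_mul]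
  field_simp

/-- The factor v/(v+1) from the masses cancels the one from `integral_kernel_add_two`, so the
integrals over [0, y/√v] drop out. -/
lemma concProb_add_two_sub {v : ℕ} (hv : 3 ≤ v) {y : ℝ} (hy : 0 < y) :
    concProb y (v + 2) - concProb y v = 2 / mass v *
      (y / √v * kernel v (y / √v) / v - ∫ t in (y / √v)..(y / √((v : ℝ) - 2)), kernel v t) := by
  have hi := fun a b => (continuous_kernel v).intervalIntegrable (μ := volume) a b
  have hv0 : (0 : ℝ) < v := by positivity
  have hm := mass_pos (v := v) (by omega)
  have hm2 : mass (v + 2) = v * mass v / (v + 1) := by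
    rw [eq_div_iff (by positivity), mul_comm, mass_add_two (by omega)]
  have h1 := integral_kernel_add_two v (y / √v)
  have h2 := intervalIntegral.integral_add_adjacent_intervals (hi 0 (y / √v))
    (hi (y / √v) (y / √((v : ℝ) - 2)))
  rw [concProb_eq_integral hv hy, concProb_eq_integral (by omega) hy, hm2, ← h2]
  push_cast
  rw [add_sub_cancel_right]
  rw [mul_comm, ← eq_div_iff (by positivity)] at h1
  rw [h1]
  field_simp
  ring

/-! ### Taylor bounds for the kernel near the endpoint -/

lemma kernel_eq_mul_exp (v : ℕ) {a t : ℝ} (q : ℝ) (hq : 0 ≤ q)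
    (h : 1 + t ^ 2 = (1 + a ^ 2) * (1 + q)) :
    kernel v t = kernel v a * Real.exp (-(((v : ℝ) + 1) / 2 * Real.log (1 + q))) := by
  rw [kernel, h, Real.mul_rpow (by positivity) (by positivity), ← kernel,
    Real.rpow_def_of_pos (by positivity : 0 < 1 + q)]
  congr 2; ring

/-- (1 - x + x²/2)(1 + x + x²/2) = 1 + x⁴/4 ≥ 1. -/
lemma exp_neg_le_quadratic {x : ℝ} (hx : 0 ≤ x) : Real.exp (-x) ≤ 1 - x + x ^ 2 / 2 := by
  have h := Real.quadratic_le_exp_of_nonneg hx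
  have h1 : (0 : ℝ) ≤ 1 - x + x ^ 2 / 2 := by nlinarith [sq_nonneg (x - 1)]
  rw [Real.exp_neg, inv_le_iff_one_le_mul₀ (Real.exp_pos x)]
  have h2 := mul_le_mul_of_nonneg_left h h1
  nlinarith [pow_nonneg hx 4]

lemma sub_sq_half_le_log_one_add {q : ℝ} (hq : 0 ≤ q) : q - q ^ 2 / 2 ≤ Real.log (1 + q) := by
  refine le_trans ?_ (Real.le_log_one_add_of_nonneg hq)
  rw [le_div_iff₀ (by positivity)]
  nlinarith [pow_nonneg hq 3]

lemma exp_neg_mul_log_bounds {n q : ℝ} (hn : 0 ≤ n) (hq : 0 ≤ q) :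
    1 - n * q ≤ Real.exp (-(n * Real.log (1 + q))) ∧
      Real.exp (-(n * Real.log (1 + q))) ≤ 1 - n * q + n * (n + 1) / 2 * q ^ 2 := by
  have l1 : Real.log (1 + q) ≤ q := by
    linarith [Real.log_le_sub_one_of_pos (by positivity : 0 < 1 + q)]
  have l2 := sub_sq_half_le_log_one_add hq
  have l0 : 0 ≤ Real.log (1 + q) := Real.log_nonneg (by linarith)
  have m1 := mul_le_mul_of_nonneg_left l1 hn
  have m2 := mul_le_mul_of_nonneg_left l2 hn
  have m0 := mul_nonneg hn l0
  constructor
  · linarith [Real.add_one_le_exp (-(n * Real.log (1 + q)))]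
  · have := exp_neg_le_quadratic m0
    have := pow_le_pow_left₀ m0 m1 2
    nlinarith

lemma kernel_bounds (v : ℕ) {a t : ℝ} (ha : 0 ≤ a) (hat : a ≤ t) :
    kernel v a * (1 - ((v : ℝ) + 1) / 2 * ((t ^ 2 - a ^ 2) / (1 + a ^ 2))) ≤ kernel v t ∧
      kernel v t ≤ kernel v a * (1 - ((v : ℝ) + 1) / 2 * ((t ^ 2 - a ^ 2) / (1 + a ^ 2)) +
        ((v : ℝ) + 1) / 2 * (((v : ℝ) + 1) / 2 + 1) / 2 * ((t ^ 2 - a ^ 2) / (1 + a ^ 2)) ^ 2) := by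
  have hq : 0 ≤ (t ^ 2 - a ^ 2) / (1 + a ^ 2) :=
    div_nonneg (by nlinarith) (by positivity)
  have h := exp_neg_mul_log_bounds (n := ((v : ℝ) + 1) / 2) (by positivity) hq
  rw [kernel_eq_mul_exp v (a := a) (t := t) _ hq (by field_simp; ring)]
  exact ⟨mul_le_mul_of_nonneg_left h.1 (kernel_pos v a).le,
    mul_le_mul_of_nonneg_left h.2 (kernel_pos v a).le⟩

/-- Factoring out powers of W - 1 displays the order of each term in 1/v. -/
lemma integral_quartic (a W A B D : ℝ) :
    ∫ t in a..(W * a), (A + B * (t ^ 2 - a ^ 2) + D * (t ^ 2 - a ^ 2) ^ 2) =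
      a * (A * (W - 1) + B * a ^ 2 * ((W - 1) ^ 2 * (W + 2) / 3) +
        D * a ^ 4 * ((W - 1) ^ 3 * (3 * W ^ 2 + 9 * W + 8) / 15)) := by
  have hd : ∀ t ∈ Set.uIcc a (W * a), HasDerivAt
      (fun t : ℝ => A * t + B * (t ^ 3 / 3 - a ^ 2 * t) +
        D * (t ^ 5 / 5 - 2 * a ^ 2 * (t ^ 3 / 3) + a ^ 4 * t))
      (A + B * (t ^ 2 - a ^ 2) + D * (t ^ 2 - a ^ 2) ^ 2) t := by
    intro t _
    have h1 := hasDerivAt_id' t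
    have h3 : HasDerivAt (fun t : ℝ => t ^ 3 / 3) (t ^ 2) t := by
      simpa using (hasDerivAt_pow 3 t).div_const 3
    have h5 : HasDerivAt (fun t : ℝ => t ^ 5 / 5) (t ^ 4) t := by
      simpa using (hasDerivAt_pow 5 t).div_const 5
    refine (((h1.const_mul A).add ((h3.sub (h1.const_mul (a ^ 2))).const_mul B)).add
      (((h5.sub (h3.const_mul (2 * a ^ 2))).add (h1.const_mul (a ^ 4))).const_mul D)).congr_deriv ?_
    ring
  rw [intervalIntegral.integral_eq_sub_of_hasDerivAt hd
    (Continuous.intervalIntegrable (by fun_prop) _ _)]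
  ring

/-- Bounds for the integral of `kernel v` over `[a, W a]`, obtained from the first and second order
Taylor polynomials of the integrand in `t ^ 2 - a ^ 2`. -/
lemma integral_kernel_bounds (v : ℕ) {a W M : ℝ} (ha : 0 < a) (hW : 1 ≤ W)
    (hM : M = ((v : ℝ) + 1) / 2 * (a ^ 2 / (1 + a ^ 2))) :
    a * kernel v a * ((W - 1) - M * ((W - 1) ^ 2 * (W + 2) / 3)) ≤
        ∫ t in a..(W * a), kernel v t ∧
      ∫ t in a..(W * a), kernel v t ≤ a * kernel v a * ((W - 1) - M * ((W - 1) ^ 2 * (W + 2) / 3) +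
        ((v : ℝ) + 1) / 2 * (((v : ℝ) + 1) / 2 + 1) / 2 * (a ^ 2 / (1 + a ^ 2)) ^ 2 *
          ((W - 1) ^ 3 * (3 * W ^ 2 + 9 * W + 8) / 15)) := by
  have hle : a ≤ W * a := by nlinarith
  have hi := (continuous_kernel v).intervalIntegrable (μ := volume) a (W * a)
  have hpos : (0 : ℝ) < 1 + a ^ 2 := by positivity
  constructor
  · have h := integral_quartic a W (kernel v a)
      (-(kernel v a * (((v : ℝ) + 1) / 2 / (1 + a ^ 2)))) 0
    refine le_trans (le_of_eq ?_) (intervalIntegral.integral_mono_on hle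
      (Continuous.intervalIntegrable (by fun_prop) _ _) hi
      (f := fun t => kernel v a + (-(kernel v a * (((v : ℝ) + 1) / 2 / (1 + a ^ 2)))) *
        (t ^ 2 - a ^ 2) + 0 * (t ^ 2 - a ^ 2) ^ 2) fun t ht => ?_)
    · rw [h, hM]; field_simp; ring
    · refine le_trans (le_of_eq ?_) (kernel_bounds v ha.le ht.1).1
      field_simp; ring
  · have h := integral_quartic a W (kernel v a)
      (-(kernel v a * (((v : ℝ) + 1) / 2 / (1 + a ^ 2))))
      (kernel v a * (((v : ℝ) + 1) / 2 * (((v : ℝ) + 1) / 2 + 1) / 2 / (1 + a ^ 2) ^ 2))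
    refine le_trans (intervalIntegral.integral_mono_on hle hi
      (Continuous.intervalIntegrable (by fun_prop) _ _)
      (g := fun t => kernel v a + (-(kernel v a * (((v : ℝ) + 1) / 2 / (1 + a ^ 2)))) *
        (t ^ 2 - a ^ 2) +
        (kernel v a * (((v : ℝ) + 1) / 2 * (((v : ℝ) + 1) / 2 + 1) / 2 / (1 + a ^ 2) ^ 2)) *
          (t ^ 2 - a ^ 2) ^ 2) fun t ht => ?_) (le_of_eq ?_)
    · refine le_trans (kernel_bounds v ha.le ht.1).2 (le_of_eq ?_)
      field_simp; ring
    · rw [h, hM]; field_simp; ring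

/-! ### Sign of the two-step difference -/

section Step

variable {v : ℕ} {y : ℝ}

/-- The ratio `√(v / (v - 2))` of the upper endpoints for `v` and `v + 2` degrees of freedom. -/
lemma sqrt_ratio_properties (hv : 3 ≤ v) :
    1 < √((v : ℝ) / (v - 2)) ∧ √((v : ℝ) / (v - 2)) ^ 2 * (v - 2) = v ∧
      y / √((v : ℝ) - 2) = √((v : ℝ) / (v - 2)) * (y / √v) := by
  have hv' : (3 : ℝ) ≤ v := by exact_mod_cast hv
  have h2 : (0 : ℝ) < v - 2 := by linarith
  have h0 : 0 < √(v : ℝ) := by positivity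
  refine ⟨?_, ?_, ?_⟩
  · rw [Real.lt_sqrt (by norm_num), lt_div_iff₀ h2]; linarith
  · rw [Real.sq_sqrt (by positivity)]; field_simp
  · rw [Real.sqrt_div (by positivity)]; field_simp

/-- Writes 1/v = (W²-1)/(2W²) so that its leading term W - 1 cancels that of the integral bounds. -/
lemma inv_eq_of_sq_mul_sub_two {v W : ℝ} (hv : 3 ≤ v) (hW : 1 < W) (h : W ^ 2 * (v - 2) = v) :
    1 / v = (W - 1) * (1 - (W - 1) * ((2 * W + 1) / (2 * W ^ 2))) := by
  have : v * (W ^ 2 - 1) = 2 * W ^ 2 := by linarith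
  have h1 : W ^ 2 - 1 ≠ 0 := by nlinarith
  rw [← eq_div_iff h1] at this
  rw [this]
  field_simp
  ring

/-- After this cancellation a factor (W-1)² is common; the hypothesis compares its coefficients,
with limits y²/2 and 3/2. -/
lemma concProb_add_two_le (hv : 3 ≤ v) (hy : 0 < y)
    (h : ((v : ℝ) + 1) / 2 * (y ^ 2 / (v + y ^ 2)) * ((√((v : ℝ) / (v - 2)) + 2) / 3) ≤
      (2 * √((v : ℝ) / (v - 2)) + 1) / (2 * √((v : ℝ) / (v - 2)) ^ 2)) :
    concProb y (v + 2) ≤ concProb y v := by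
  have hv' : (3 : ℝ) ≤ v := by exact_mod_cast hv
  obtain ⟨hW, hWv, hb⟩ := sqrt_ratio_properties (y := y) hv
  set W := √((v : ℝ) / (v - 2))
  have hm := mass_pos (v := v) (by omega)
  have ha : 0 < y / √v := by positivity
  have hk := mul_pos ha (kernel_pos v (y / √v))
  have hasq : (y / √v) ^ 2 / (1 + (y / √v) ^ 2) = y ^ 2 / (v + y ^ 2) := by
    rw [div_pow, Real.sq_sqrt (by positivity)]; field_simp
  have hB := (integral_kernel_bounds v ha hW.le (by rw [hasq])).1
  have hstep := concProb_add_two_sub hv hy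
  have hinv := inv_eq_of_sq_mul_sub_two hv' hW hWv
  rw [← sub_nonpos, hstep, hb]
  refine mul_nonpos_of_nonneg_of_nonpos (by positivity) ?_
  rw [sub_nonpos]
  refine le_trans ?_ hB
  rw [div_eq_mul_one_div, hinv]
  refine mul_le_mul_of_nonneg_left ?_ hk.le
  nlinarith [mul_le_mul_of_nonneg_left h (sq_nonneg (W - 1))]

lemma concProb_le_add_two (hv : 3 ≤ v) (hy : 0 < y)
    (h : (2 * √((v : ℝ) / (v - 2)) + 1) / (2 * √((v : ℝ) / (v - 2)) ^ 2) +
      ((v : ℝ) + 1) / 2 * (((v : ℝ) + 1) / 2 + 1) / 2 * (y ^ 2 / (v + y ^ 2)) ^ 2 *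
        ((√((v : ℝ) / (v - 2)) - 1) *
          (3 * √((v : ℝ) / (v - 2)) ^ 2 + 9 * √((v : ℝ) / (v - 2)) + 8) / 15) ≤
      ((v : ℝ) + 1) / 2 * (y ^ 2 / (v + y ^ 2)) * ((√((v : ℝ) / (v - 2)) + 2) / 3)) :
    concProb y v ≤ concProb y (v + 2) := by
  have hv' : (3 : ℝ) ≤ v := by exact_mod_cast hv
  obtain ⟨hW, hWv, hb⟩ := sqrt_ratio_properties (y := y) hv
  set W := √((v : ℝ) / (v - 2))
  have hm := mass_pos (v := v) (by omega)
  have ha : 0 < y / √v := by positivity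
  have hk := mul_pos ha (kernel_pos v (y / √v))
  have hasq : (y / √v) ^ 2 / (1 + (y / √v) ^ 2) = y ^ 2 / (v + y ^ 2) := by
    rw [div_pow, Real.sq_sqrt (by positivity)]; field_simp
  have hB := (integral_kernel_bounds v ha hW.le (by rw [hasq])).2
  have hstep := concProb_add_two_sub hv hy
  have hinv := inv_eq_of_sq_mul_sub_two hv' hW hWv
  rw [← sub_nonneg, hstep, hb]
  refine mul_nonneg (by positivity) ?_
  rw [sub_nonneg]
  refine le_trans hB ?_
  rw [div_eq_mul_one_div _ (v : ℝ), hinv, hasq]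
  refine mul_le_mul_of_nonneg_left ?_ hk.le
  nlinarith [mul_le_mul_of_nonneg_left h (sq_nonneg (W - 1))]

lemma concProb_add_two_le_of_le_one (hv : 3 ≤ v) (hy : 0 < y) (hy1 : y ≤ 1) :
    concProb y (v + 2) ≤ concProb y v := by
  have hv' : (3 : ℝ) ≤ v := by exact_mod_cast hv
  refine concProb_add_two_le hv hy ?_
  obtain ⟨hW, hWv, -⟩ := sqrt_ratio_properties (y := y) hv
  set W := √((v : ℝ) / (v - 2))
  have hW3 : W ^ 2 ≤ 3 := by nlinarith
  have hM : ((v : ℝ) + 1) / 2 * (y ^ 2 / (v + y ^ 2)) ≤ 1 / 2 := by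
    rw [← mul_div_assoc, div_le_div_iff₀ (by positivity) (by norm_num)]
    have hy2 : y ^ 2 ≤ 1 := pow_le_one₀ hy.le hy1
    nlinarith
  refine (mul_le_mul_of_nonneg_right hM (by linarith)).trans ?_
  rw [le_div_iff₀ (by positivity)]
  -- From W² ≤ 3: W³ + 2W² ≤ 3W + 6 ≤ 6W + 3.
  nlinarith

/-- At y² = 3 the limits coincide, so the next order in 1/v must decide; smaller y only decreases
the left side. -/
lemma concProb_add_two_le_of_le_sqrt_three (hv : 100 ≤ v) (hy : 0 < y) (hy3 : y ^ 2 ≤ 3) :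
    concProb y (v + 2) ≤ concProb y v := by
  have hv' : (100 : ℝ) ≤ v := by exact_mod_cast hv
  refine concProb_add_two_le (by omega) hy ?_
  obtain ⟨hW, hWv, -⟩ := sqrt_ratio_properties (v := v) (y := y) (by omega)
  set W := √((v : ℝ) / (v - 2))
  have hM : ((v : ℝ) + 1) / 2 * (y ^ 2 / (v + y ^ 2)) ≤ 3 / 2 * ((v + 1) / (v + 3)) := by
    rw [← mul_div_assoc, ← mul_div_assoc, div_le_div_iff₀ (by positivity) (by positivity)]
    have : y ^ 2 * (v + 3) ≤ 3 * (v + y ^ 2) := by nlinarith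
    nlinarith [mul_le_mul_of_nonneg_left this (by positivity : (0 : ℝ) ≤ v + 1)]
  refine (mul_le_mul_of_nonneg_right hM (by linarith)).trans ?_
  have hW2 : W ≤ 2 := by
    by_contra hc
    push Not at hc
    nlinarith [mul_self_nonneg (W - 2)]
  have hWl : 1 ≤ (W - 1) * v := by
    by_contra hc
    push Not at hc
    have h1 : v * W < v + 1 := by linarith
    have h2 : (v * W) ^ 2 < (v + 1) ^ 2 := pow_lt_pow_left₀ h1 (by positivity) two_ne_zero
    nlinarith
  -- Cleared of v - 2, the two sides differ by (W-1)(v²+v) - 18 - 12(W-1), and (W-1)v ≥ 1 makes the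
  -- first term at least v + 1.
  have key : W ^ 2 * ((W + 2) * (v + 1)) ≤ (2 * W + 1) * (v + 3) := by
    have : W ^ 2 = v / (v - 2) := by rw [eq_div_iff (by linarith)]; exact hWv
    rw [this, div_mul_eq_mul_div, div_le_iff₀ (by linarith)]
    nlinarith [mul_le_mul_of_nonneg_right hWl (by linarith : (0 : ℝ) ≤ v + 1)]
  have e : 3 / 2 * (((v : ℝ) + 1) / (v + 3)) * ((W + 2) / 3) =
      (W + 2) * (v + 1) / (2 * (v + 3)) := by field_simp
  rw [e, div_le_div_iff₀ (by positivity) (by positivity)]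
  linarith

/-- The errors are y⁴/(2v) from the main coefficient and 3y⁴/(8v) from the Taylor remainder; their
sum 7y⁴/(8v) is below the gap (y²-3)/2 ≥ y⁴/v. -/
lemma concProb_le_add_two_of_sqrt_three_lt (hv : 100 ≤ v) (hy : 0 < y) (hy3 : 3 < y ^ 2)
    (h : 2 * y ^ 4 ≤ (y ^ 2 - 3) * v) :
    concProb y v ≤ concProb y (v + 2) := by
  have hv' : (100 : ℝ) ≤ v := by exact_mod_cast hv
  refine concProb_le_add_two (by omega) hy ?_
  obtain ⟨hW, hWv, -⟩ := sqrt_ratio_properties (v := v) (y := y) (by omega)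
  set W := √((v : ℝ) / (v - 2))
  have hWu : (W - 1) ≤ 2 / v := by
    rw [le_div_iff₀ (by positivity)]
    by_contra hc
    push Not at hc
    have h1 : v + 2 < v * W := by linarith
    have h2 : (v + 2 : ℝ) ^ 2 < (v * W) ^ 2 := pow_lt_pow_left₀ h1 (by positivity) two_ne_zero
    nlinarith
  have hW2 : W ≤ 51 / 50 := by
    have : 2 / (v : ℝ) ≤ 2 / 100 := by gcongr
    linarith
  have h1 : (2 * W + 1) / (2 * W ^ 2) ≤ 3 / 2 := by
    rw [div_le_div_iff₀ (by positivity) (by norm_num)]; nlinarith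
  have hN : ((v : ℝ) + 1) / 2 * (((v : ℝ) + 1) / 2 + 1) / 2 * (y ^ 2 / (v + y ^ 2)) ^ 2 ≤
      y ^ 4 / 8 := by
    rw [div_pow, ← mul_div_assoc, div_le_div_iff₀ (by positivity) (by norm_num)]
    have : ((v : ℝ) + 1) * (v + 3) ≤ (v + y ^ 2) ^ 2 := by nlinarith
    nlinarith [mul_le_mul_of_nonneg_left this (by positivity : 0 ≤ y ^ 4)]
  have hR : (W - 1) * (3 * W ^ 2 + 9 * W + 8) / 15 ≤ 3 / (v : ℝ) := by
    have : (3 * W ^ 2 + 9 * W + 8) / 15 ≤ 3 / 2 := by nlinarith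
    calc (W - 1) * (3 * W ^ 2 + 9 * W + 8) / 15 = (W - 1) * ((3 * W ^ 2 + 9 * W + 8) / 15) := by
          ring
      _ ≤ 2 / (v : ℝ) * (3 / 2) := by gcongr
      _ = 3 / (v : ℝ) := by ring
  have hR0 : 0 ≤ (W - 1) * (3 * W ^ 2 + 9 * W + 8) / 15 := by
    have : 0 < W - 1 := by linarith
    positivity
  have h2 := mul_le_mul hN hR hR0 (by positivity)
  have hM : y ^ 2 / 2 - y ^ 4 / (2 * v) ≤ ((v : ℝ) + 1) / 2 * (y ^ 2 / (v + y ^ 2)) := by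
    have e : y ^ 2 / 2 - y ^ 4 / (2 * v) = y ^ 2 * (v - y ^ 2) / (2 * v) := by field_simp
    rw [e, ← mul_div_assoc, div_le_div_iff₀ (by positivity) (by positivity)]
    have : (v - y ^ 2) * (v + y ^ 2) ≤ ((v : ℝ) + 1) * v := by nlinarith [sq_nonneg (y ^ 2)]
    nlinarith [mul_le_mul_of_nonneg_left this (by positivity : 0 ≤ y ^ 2)]
  have hM0 : 0 ≤ ((v : ℝ) + 1) / 2 * (y ^ 2 / (v + y ^ 2)) := by positivity
  have h3 : ((v : ℝ) + 1) / 2 * (y ^ 2 / (v + y ^ 2)) * 1 ≤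
      ((v : ℝ) + 1) / 2 * (y ^ 2 / (v + y ^ 2)) * ((W + 2) / 3) :=
    mul_le_mul_of_nonneg_left (by linarith) hM0
  have h4 : 2 * (y ^ 4 / v) ≤ y ^ 2 - 3 := by
    rw [← mul_div_assoc, div_le_iff₀ (by positivity)]; exact h
  have e1 : y ^ 4 / 8 * (3 / v) = 3 / 8 * (y ^ 4 / v) := by ring
  have e2 : y ^ 4 / (2 * v) = 1 / 2 * (y ^ 4 / v) := by field_simp
  have h5 : 0 ≤ y ^ 4 / v := by positivity
  rw [e1] at h2
  rw [e2] at hM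
  linarith

end Step

/-! ### Convergence to the normal law -/

lemma kernel_div_sqrt (v : ℕ) (x : ℝ) :
    kernel v (x / √v) = (1 + x ^ 2 / v) ^ (-(((v : ℝ) + 1) / 2)) := by
  rw [kernel, div_pow, Real.sq_sqrt (by positivity)]

lemma tendsto_kernel_div_sqrt (x : ℝ) :
    Tendsto (fun v : ℕ => kernel v (x / √v)) atTop (𝓝 (Real.exp (-x ^ 2 / 2))) := by
  have h1 := (Real.tendsto_one_add_div_pow_exp (x ^ 2)).rpow_const (p := -(1 / 2))
    (Or.inl (Real.exp_pos _).ne')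
  have h2 : Tendsto (fun v : ℕ => (1 + x ^ 2 / (v : ℝ)) ^ (-(1 / 2) : ℝ)) atTop (𝓝 1) := by
    have h : Tendsto (fun v : ℕ => 1 + x ^ 2 / (v : ℝ)) atTop (𝓝 (1 + 0)) :=
      (tendsto_const_div_atTop_nhds_zero_nat (x ^ 2)).const_add 1
    simpa using h.rpow_const (p := -(1 / 2)) (Or.inl (by norm_num))
  have e : Real.exp (-x ^ 2 / 2) = Real.exp (x ^ 2) ^ (-(1 / 2) : ℝ) * 1 := by
    rw [← Real.exp_mul, mul_one]; congr 1; ring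
  rw [e]
  refine (h1.mul h2).congr fun v => ?_
  have h0 : (0 : ℝ) < 1 + x ^ 2 / v := by positivity
  rw [kernel_div_sqrt, ← Real.rpow_natCast, ← Real.rpow_mul h0.le, ← Real.rpow_add h0]
  congr 1; ring

/-- Bernoulli's inequality gives one Cauchy-type majorant for all v, as dominated convergence
requires. -/
lemma kernel_div_sqrt_le {v : ℕ} (hv : 1 ≤ v) (x : ℝ) :
    kernel v (x / √v) ≤ (1 + (x / √2) ^ 2)⁻¹ := by
  have hv' : (1 : ℝ) ≤ v := by exact_mod_cast hv
  have h0 : (0 : ℝ) ≤ x ^ 2 / v := by positivity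
  rw [kernel_div_sqrt, Real.rpow_neg (by positivity), div_pow, Real.sq_sqrt (by norm_num)]
  refine inv_anti₀ (by positivity) ?_
  refine le_trans ?_ (one_add_mul_self_le_rpow_one_add (by linarith) (by linarith))
  have : ((v : ℝ) + 1) / 2 * (x ^ 2 / v) = x ^ 2 / 2 + x ^ 2 / (2 * v) := by field_simp
  have h1 : (0 : ℝ) ≤ x ^ 2 / (2 * v) := by positivity
  linarith

lemma integrable_inv_one_add_div_sqrt_two_sq :
    Integrable (fun x : ℝ => (1 + (x / √2) ^ 2)⁻¹) :=
  integrable_inv_one_add_sq.comp_div (by positivity)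

lemma tendsto_sqrt_mul_mass :
    Tendsto (fun v : ℕ => √(v : ℝ) * mass v) atTop (𝓝 √(2 * Real.pi)) := by
  have h := tendsto_integral_filter_of_dominated_convergence (μ := volume) (l := atTop)
    (F := fun (v : ℕ) x => kernel v (x / √v)) (f := fun x => Real.exp (-x ^ 2 / 2))
    (fun x => (1 + (x / √2) ^ 2)⁻¹)
    (Eventually.of_forall fun v => ((continuous_kernel v).comp
      (continuous_id.div_const _)).aestronglyMeasurable)
    ?_ integrable_inv_one_add_div_sqrt_two_sq
    (Eventually.of_forall fun x => tendsto_kernel_div_sqrt x)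
  · have e : ∫ x : ℝ, Real.exp (-x ^ 2 / 2) = √(2 * Real.pi) := by
      have := integral_gaussian (1 / 2)
      rw [show Real.pi / (1 / 2) = 2 * Real.pi by ring] at this
      rw [← this]
      congr 1; ext x; congr 1; ring
    rw [e] at h
    refine h.congr fun v => ?_
    rw [Measure.integral_comp_div (kernel v), abs_of_nonneg (Real.sqrt_nonneg _), smul_eq_mul, mass]
  · filter_upwards [eventually_ge_atTop 1] with v hv
    refine Eventually.of_forall fun x => ?_
    rw [Real.norm_of_nonneg (kernel_pos _ _).le]
    exact kernel_div_sqrt_le hv x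

lemma tendsto_mul_sqrt_ratio (y : ℝ) :
    Tendsto (fun v : ℕ => y * √((v : ℝ) / ((v : ℝ) - 2))) atTop (𝓝 y) := by
  have h : Tendsto (fun v : ℕ => (1 - 2 / (v : ℝ))⁻¹) atTop (𝓝 (1 - 0)⁻¹) :=
    ((tendsto_const_div_atTop_nhds_zero_nat 2).const_sub 1).inv₀ (by norm_num)
  have h2 := (h.sqrt).const_mul y
  simp only [sub_zero, inv_one, Real.sqrt_one, mul_one] at h2
  refine h2.congr' ?_
  filter_upwards [eventually_ge_atTop 3] with v hv
  have hv' : (3 : ℝ) ≤ v := by exact_mod_cast hv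
  have : (v : ℝ) - 2 ≠ 0 := by linarith
  congr 2
  field_simp

lemma two_mul_Phi_sub_one {y : ℝ} (hy : 0 ≤ y) :
    2 * Phi y - 1 = (√(2 * Real.pi))⁻¹ *
      ∫ x, Set.indicator {x : ℝ | |x| ≤ y} (fun x => Real.exp (-x ^ 2 / 2)) x := by
  have hm : MeasurableSet {t : ℝ | |t| ≤ y} := measurableSet_le (by fun_prop) (by fun_prop)
  have hs : (gaussianReal 0 1).map (fun x => -x) = gaussianReal 0 1 := by
    rw [gaussianReal_map_neg, neg_zero]
  rw [integral_indicator hm, Phi, ← measureReal_abs_le hs hy, measureReal_def,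
    gaussianReal_apply_eq_integral 0 one_ne_zero, ENNReal.toReal_ofReal, ← integral_const_mul]
  · congr 1; ext x; simp [gaussianPDFReal]
  · exact setIntegral_nonneg hm fun x _ => gaussianPDFReal_nonneg _ _ _

/-- Convergence of the standardised `t`-distributions to the normal distribution. -/
lemma tendsto_concProb {y : ℝ} (hy : 0 < y) :
    Tendsto (concProb y) atTop (𝓝 (2 * Phi y - 1)) := by
  have hm : ∀ c : ℝ, MeasurableSet {t : ℝ | |t| ≤ c} := fun c =>
    measurableSet_le (by fun_prop) (by fun_prop)
  have h := tendsto_integral_filter_of_dominated_convergence (μ := volume) (l := atTop)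
    (F := fun (v : ℕ) => Set.indicator {x : ℝ | |x| ≤ y * √((v : ℝ) / ((v : ℝ) - 2))}
      (fun x => kernel v (x / √v)))
    (f := Set.indicator {x : ℝ | |x| ≤ y} (fun x => Real.exp (-x ^ 2 / 2)))
    (fun x => (1 + (x / √2) ^ 2)⁻¹)
    (Eventually.of_forall fun v => ((continuous_kernel v).comp
      (continuous_id.div_const _)).aestronglyMeasurable.indicator (hm _))
    ?_ integrable_inv_one_add_div_sqrt_two_sq ?_
  · rw [two_mul_Phi_sub_one hy.le]
    refine ((tendsto_sqrt_mul_mass.inv₀ (by positivity)).mul h).congr' ?_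
    filter_upwards [eventually_ge_atTop 3] with v hv
    rw [← measureReal_conc hv hy, law_real_apply (by omega) (hm _), integral_indicator (hm _),
      ← integral_const_mul]
    simp_rw [pdfReal_eq (show 1 ≤ v by omega)]
  · filter_upwards [eventually_ge_atTop 1] with v hv
    refine Eventually.of_forall fun x => (norm_indicator_le_norm_self _ _).trans ?_
    rw [Real.norm_of_nonneg (kernel_pos _ _).le]
    exact kernel_div_sqrt_le hv x
  -- The indicators with moving endpoints converge except possibly at x = ±y, a null set.
  · have hne : ∀ᵐ x : ℝ, x ≠ y ∧ x ≠ -y := by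
      filter_upwards [compl_mem_ae_iff.2 (measure_singleton y),
        compl_mem_ae_iff.2 (measure_singleton (-y))] with x h1 h2 using ⟨h1, h2⟩
    filter_upwards [hne] with x hx
    have hc := tendsto_mul_sqrt_ratio y
    have hx' : |x| ≠ y := fun h => by
      rcases eq_or_eq_neg_of_abs_eq h with h | h
      exacts [hx.1 h, hx.2 h]
    rcases hx'.lt_or_gt with h | h
    · rw [Set.indicator_of_mem (show x ∈ {x : ℝ | |x| ≤ y} from h.le)]
      refine (tendsto_kernel_div_sqrt x).congr' ?_
      filter_upwards [hc.eventually_const_lt h] with v hv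
      rw [Set.indicator_of_mem]
      exact hv.le
    · rw [Set.indicator_of_notMem (show x ∉ {x : ℝ | |x| ≤ y} from not_le.2 h)]
      refine tendsto_const_nhds.congr' ?_
      filter_upwards [hc.eventually_lt_const h] with v hv
      rw [Set.indicator_of_notMem]
      exact not_le.2 hv

/-! ### Infima of sequences monotone along steps of two -/

section TwoStep

variable {f : ℕ → ℝ} {m : ℕ} {L r : ℝ}

lemma le_add_two_mul (hf : ∀ v ≥ m, f (v + 2) ≤ f v) {v : ℕ} (hv : m ≤ v) (k : ℕ) :
    f (v + 2 * k) ≤ f v := by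
  induction k with
  | zero => simp
  | succ k ih => exact (hf (v + 2 * k) (by omega)).trans ih

/-- A sequence which is eventually antitone along steps of two stays above its limit. -/
lemma limit_le_of_two_step (hf : ∀ v ≥ m, f (v + 2) ≤ f v) (hL : Tendsto f atTop (𝓝 L))
    {v : ℕ} (hv : m ≤ v) : L ≤ f v := by
  have ht : Tendsto (fun k : ℕ => v + 2 * k) atTop atTop :=
    tendsto_atTop_mono (fun k => show k ≤ v + 2 * k by omega) tendsto_id
  exact le_of_tendsto (hL.comp ht) (Eventually.of_forall fun k => le_add_two_mul hf hv k)

/-- Each parity class is monotone separately, so two starting values are needed. -/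
lemma exists_le_of_two_step (hf : ∀ v ≥ m, f v ≤ f (v + 2)) {v : ℕ} (hv : m ≤ v) :
    f m ≤ f v ∨ f (m + 1) ≤ f v := by
  have hf' : ∀ v ≥ m, (-f) (v + 2) ≤ (-f) v := fun v hv => neg_le_neg (hf v hv)
  obtain ⟨k, hk | hk⟩ : ∃ k, v = m + 2 * k ∨ v = m + 1 + 2 * k :=
    ⟨(v - m) / 2, by omega⟩
  · left
    rw [hk]
    exact neg_le_neg_iff.1 (le_add_two_mul hf' le_rfl k)
  · right
    rw [hk]
    exact neg_le_neg_iff.1 (le_add_two_mul hf' (Nat.le_succ m) k)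

lemma minUpTo_le {v : ℕ} (h3 : 3 ≤ v) (hv : v ≤ ⌊r⌋₊ + 3) : minUpTo r f ≤ f v :=
  Finset.inf'_le _ (Finset.mem_Icc.2 ⟨h3, hv⟩)

lemma le_minUpTo {a : ℝ} (h : ∀ v, 3 ≤ v → a ≤ f v) : a ≤ minUpTo r f :=
  Finset.le_inf' _ _ fun v hv => h v (Finset.mem_Icc.1 hv).1

/-- Testing a against all lower bounds c allows an infimum that is only a limit; b merely ensures
boundedness below. -/
lemma iInf_eq_of_le {a b : ℝ} (hb : ∀ v, 3 ≤ v → b ≤ f v)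
    (ha : ∀ c, (∀ v, 3 ≤ v → c ≤ f v) → c ≤ a) (hf : ∀ v, 3 ≤ v → a ≤ f v) :
    ⨅ v : {v : ℕ // 3 ≤ v}, f v = a := by
  have : Nonempty {v : ℕ // 3 ≤ v} := ⟨⟨3, le_rfl⟩⟩
  have hbdd : BddBelow (Set.range fun v : {v : ℕ // 3 ≤ v} => f v) :=
    ⟨b, by rintro _ ⟨v, rfl⟩; exact hb v v.2⟩
  exact le_antisymm (ha _ fun v hv => ciInf_le hbdd ⟨v, hv⟩) (le_ciInf fun v => hf v v.2)

/-- Monotonicity from ⌊r⌋ + 2 on puts both starting values, ⌊r⌋ + 2 and ⌊r⌋ + 3, inside the minimum;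
`hr` makes them at least 3. -/
lemma iInf_eq_minUpTo (hr : 1 ≤ ⌊r⌋₊) (hf : ∀ v ≥ ⌊r⌋₊ + 2, f v ≤ f (v + 2)) :
    ⨅ v : {v : ℕ // 3 ≤ v}, f v = minUpTo r f := by
  have key : ∀ v, 3 ≤ v → minUpTo r f ≤ f v := fun v h3 => by
    by_cases hv : v ≤ ⌊r⌋₊ + 3
    · exact minUpTo_le h3 hv
    · rcases exists_le_of_two_step hf (show ⌊r⌋₊ + 2 ≤ v by omega) with h | h
      · exact (minUpTo_le (by omega) (by omega)).trans h
      · exact (minUpTo_le (by omega) (by omega)).trans h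
  exact iInf_eq_of_le key (fun c hc => le_minUpTo hc) key

lemma iInf_eq_min_minUpTo (hf : ∀ v ≥ ⌊r⌋₊ + 2, f (v + 2) ≤ f v)
    (hL : Tendsto f atTop (𝓝 L)) :
    ⨅ v : {v : ℕ // 3 ≤ v}, f v = min (minUpTo r f) L := by
  have key : ∀ v, 3 ≤ v → min (minUpTo r f) L ≤ f v := fun v h3 => by
    by_cases hv : v ≤ ⌊r⌋₊ + 3
    · exact (min_le_left _ _).trans (minUpTo_le h3 hv)
    · exact (min_le_right _ _).trans (limit_le_of_two_step hf hL (by omega))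
  refine iInf_eq_of_le key (fun c hc => le_min (le_minUpTo hc) ?_) key
  refine ge_of_tendsto hL ?_
  filter_upwards [eventually_ge_atTop 3] with v hv using hc v hv

end TwoStep

/-! ### The explicit bounds and the final assembly -/

lemma one_sub_concProb (y : ℝ) : (fun v => 1 - concProb y v) =
    fun v : ℕ => 2 - 2 * F v (y * √((v : ℝ) / ((v : ℝ) - 2))) := by
  funext v; unfold concProb; ring

lemma minUpTo_one (f : ℕ → ℝ) : minUpTo 1 f = min (f 3) (f 4) := by
  refine le_antisymm (le_min (minUpTo_le le_rfl (by simp)) (minUpTo_le (by simp) (by simp))) ?_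
  refine Finset.le_inf' _ _ fun v hv => ?_
  rw [Finset.mem_Icc, Nat.floor_one] at hv
  obtain rfl | rfl : v = 3 ∨ v = 4 := by omega
  exacts [min_le_left _ _, min_le_right _ _]

lemma hundred_le_v₀ (y : ℝ) : 100 ≤ v₀ y := by
  simp [v₀, V₃, V₂, V₁]

lemma hundred_le_floor_v₀ (y : ℝ) : 100 ≤ ⌊v₀ y⌋₊ :=
  Nat.le_floor (by exact_mod_cast hundred_le_v₀ y)

lemma four_mul_pow_four_le_C₃ {y : ℝ} (hy : 0 ≤ y) : 4 * y ^ 4 ≤ C₃ y := by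
  have h1 : 0 ≤ C₁ y := by unfold C₁; positivity
  have h2 : 0 ≤ C₂ y := by unfold C₂; positivity
  have := pow_nonneg hy 4
  unfold C₃
  nlinarith

/-- Of `v₀` only two features matter: it is at least 100, and its last term with C₃ ≥ 4y⁴ gives 8y⁴
≤ (y²-3)v, more than the required 2y⁴. -/
lemma concProb_le_add_two_of_v₀ {y : ℝ} (hy : 0 < y) (hy3 : 3 < y ^ 2) {v : ℕ}
    (hv : ⌊v₀ y⌋₊ + 2 ≤ v) : concProb y v ≤ concProb y (v + 2) := by
  have h100 := hundred_le_floor_v₀ y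
  refine concProb_le_add_two_of_sqrt_three_lt (by omega) hy hy3 ?_
  have h1 : v₀ y < v := (Nat.lt_floor_add_one (v₀ y)).trans (by exact_mod_cast (by omega))
  have h2 : 2 * C₃ y / |y ^ 2 - 3| + 1 ≤ v₀ y := le_max_right _ _
  have h3 : 2 * C₃ y / |y ^ 2 - 3| ≤ v := by linarith
  rw [abs_of_pos (by linarith), div_le_iff₀ (by linarith)] at h3
  have := four_mul_pow_four_le_C₃ hy.le
  have := pow_nonneg hy.le 4
  linarith

end StudentT

open StudentT in
theorem theorem1p2 (y : ℝ) (hy : 0 < y) :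
    -- (i)
    StudentT.C y = 1 / 2 ∧
    -- (ii)
    ((y ≤ 1 → StudentT.T y = 2 * StudentT.Phi y - 1) ∧
      (1 < y → y < √3 →
        StudentT.T y =
          min (StudentT.minUpTo (StudentT.v₀ y) fun v : ℕ =>
              2 * StudentT.F v (y * √((v : ℝ) / ((v : ℝ) - 2))) - 1)
            (2 * StudentT.Phi y - 1)) ∧
      (y = √3 →
        StudentT.T y =
          min (StudentT.minUpTo StudentT.vbar₀ fun v : ℕ =>
              2 * StudentT.F v √(3 * (v : ℝ) / ((v : ℝ) - 2)) - 1)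
            (2 * StudentT.Phi √3 - 1)) ∧
      (√3 < y →
        StudentT.T y =
          StudentT.minUpTo (StudentT.v₀ y) fun v : ℕ =>
            2 * StudentT.F v (y * √((v : ℝ) / ((v : ℝ) - 2))) - 1)) ∧
    -- (iii)
    ((y ≤ 1 →
        StudentT.H y =
          min (2 - 2 * StudentT.F 3 (y * √((3 : ℝ) / ((3 : ℝ) - 2))))
            (2 - 2 * StudentT.F 4 (y * √((4 : ℝ) / ((4 : ℝ) - 2))))) ∧
      (1 < y → y < √3 →
        StudentT.H y =
          StudentT.minUpTo (StudentT.v₀ y) fun v : ℕ =>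
            2 - 2 * StudentT.F v (y * √((v : ℝ) / ((v : ℝ) - 2)))) ∧
      (y = √3 →
        StudentT.H y =
          StudentT.minUpTo StudentT.vbar₀ fun v : ℕ =>
            2 - 2 * StudentT.F v √(3 * (v : ℝ) / ((v : ℝ) - 2))) ∧
      (√3 < y →
        StudentT.H y =
          min (StudentT.minUpTo (StudentT.v₀ y) fun v : ℕ =>
              2 - 2 * StudentT.F v (y * √((v : ℝ) / ((v : ℝ) - 2))))
            (2 - 2 * StudentT.Phi y))) := by
  have hlim := tendsto_concProb hy
  have hlim' : Filter.Tendsto (fun v => 1 - concProb y v) Filter.atTop (nhds (2 - 2 * Phi y)) := by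
    convert hlim.const_sub 1 using 2; ring
  have hsqrt : ∀ v : ℕ, √(3 * (v : ℝ) / ((v : ℝ) - 2)) = √3 * √((v : ℝ) / ((v : ℝ) - 2)) := by
    intro v; rw [mul_div_assoc, Real.sqrt_mul (by norm_num)]
  have hf100 := hundred_le_floor_v₀ y
  have hbar : 100 ≤ ⌊vbar₀⌋₊ := Nat.le_floor (by norm_num [vbar₀])
  have down : y ≤ √3 → ∀ v ≥ 100, concProb y (v + 2) ≤ concProb y v := fun h v hv =>
    concProb_add_two_le_of_le_sqrt_three hv hy ((Real.le_sqrt' hy).1 h)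
  have up : √3 < y → ∀ v ≥ ⌊v₀ y⌋₊ + 2, concProb y v ≤ concProb y (v + 2) := fun h v hv =>
    concProb_le_add_two_of_v₀ hy ((Real.sqrt_lt' hy).1 h) hv
  have down_one : y ≤ 1 → ∀ v ≥ 3, concProb y (v + 2) ≤ concProb y v := fun h v hv =>
    concProb_add_two_le_of_le_one hv hy h
  refine ⟨C_eq_half y, ⟨fun h => ?_, fun _ h => ?_, fun h => ?_, fun h => ?_⟩,
    fun h => ?_, fun _ h => ?_, fun h => ?_, fun h => ?_⟩
  -- With r = 1 monotonicity starts at ⌊1⌋ + 2 = 3, so the limit lies below every term and absorbs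
  -- the minimum.
  · rw [T_eq_iInf hy, iInf_eq_min_minUpTo (r := 1)
      (fun v hv => down_one h v (by simpa using hv)) hlim]
    exact min_eq_right (le_minUpTo fun v hv => limit_le_of_two_step (down_one h) hlim hv)
  · rw [T_eq_iInf hy]
    exact iInf_eq_min_minUpTo (fun v hv => down h.le v (by omega)) hlim
  · rw [T_eq_iInf hy]
    simp_rw [hsqrt]
    rw [← h]
    exact iInf_eq_min_minUpTo (fun v hv => down h.le v (by omega)) hlim
  · rw [T_eq_iInf hy]
    exact iInf_eq_minUpTo (by omega) (up h)
  · rw [H_eq_iInf hy, iInf_eq_minUpTo (r := 1) (f := fun v => 1 - concProb y v) (by simp)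
      (fun v hv => sub_le_sub_left (down_one h v (by simpa using hv)) 1), one_sub_concProb,
      minUpTo_one]
    norm_num
  · rw [H_eq_iInf hy, ← one_sub_concProb]
    exact iInf_eq_minUpTo (f := fun v => 1 - concProb y v) (by omega)
      (fun v hv => sub_le_sub_left (down h.le v (by omega)) 1)
  · rw [H_eq_iInf hy]
    simp_rw [hsqrt]
    rw [← h, ← one_sub_concProb]
    exact iInf_eq_minUpTo (f := fun v => 1 - concProb y v) (by omega)
      (fun v hv => sub_le_sub_left (down h.le v (by omega)) 1)
  · rw [H_eq_iInf hy, ← one_sub_concProb]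
    exact iInf_eq_min_minUpTo (f := fun v => 1 - concProb y v)
      (fun v hv => sub_le_sub_left (up h v hv) 1) hlim'
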